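/- Let $L^2(\mathbb R)$ be the complex Hilbert space of square-integrable functions, let $P=-i\,d/dx$ and let $Q$ be multiplication by $x$, as self-adjoint operators in $L^2(\mathbb R)$. Let $f,g:\mathbb R\to\mathbb R$ be bounded measurable functions (it is enough that they are Lebesgue measurable and essentially bounded), and let $f(P)$, $g(Q)$ be the corresponding bounded operators: $g(Q)$ is multiplication by $g(x)$, and $f(P)=\mathcal F^{-1}M_f\mathcal F$, where $(\mathcal F\psi)(\xi)=(2\pi)^{-1/2}\int_{\mathbb R}e^{-i\xi x}\psi(x)\,dx$ is the unitary Fourier transform and $M_f$ is multiplication by $f(\xi)$. Then $[f(P),g(Q)]=f(P)g(Q)-g(Q)f(P)=0$ if and only if at least one of the following holds: 1. $f$ is almost everywhere equal to a constant, or $g$ is almost everywhere equal to a constant; 2. there are real numbers $\tau_f,\tau_g>0$ with $\tau_f\tau_g=2\pi$, a function equal to $f$ almost everywhere that is periodic with period $\tau_f$, and a function equal to $g$ almost everywhere that is periodic with period $\tau_g$. (The periods need not be the smallest ones.) The same equivalence holds for complex-valued bounded measurable functions $f,g:\mathbb R\to\mathbb C$ (with complex constants and complex-valued periodic versions). -/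

import Mathlib

open MeasureTheory
open scoped ENNReal FourierTransform

noncomputable section

/-- The complex Hilbert space `L²(ℝ)`, with respect to Lebesgue measure. -/
abbrev L2R : Type := Lp ℂ 2 (volume : Measure ℝ)

/-- Dilating an essentially bounded function by `2π` gives an essentially bounded function. -/
theorem memLp_top_comp_two_pi_mul {f : ℝ → ℂ} (hf : MemLp f ∞ volume) :
    MemLp (fun ξ : ℝ => f (2 * Real.pi * ξ)) ∞ volume := by
  have hq : Measure.QuasiMeasurePreserving (fun ξ : ℝ => 2 * Real.pi * ξ) volume volume := by
    refine ⟨by fun_prop, ?_⟩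
    rw [Real.map_volume_mul_left Real.two_pi_pos.ne']
    exact Measure.smul_absolutelyContinuous
  refine ⟨hf.1.comp_quasiMeasurePreserving hq, lt_of_le_of_lt ?_ hf.2⟩
  rw [eLpNorm_exponent_top, eLpNorm_exponent_top]
  refine essSup_le_of_ae_le _ ?_
  exact hq.ae (ae_le_essSup (f := fun x => ‖f x‖ₑ) (μ := (volume : Measure ℝ)))

/-- The bounded operator `g(Q)` on `L²(ℝ)`, for `g ∈ L^∞(ℝ)`, where `Q` is multiplication by `x`:
multiplication by `g`, that is `(g(Q) ψ)(x) = g(x) ψ(x)`. -/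
def funQ (g : ℝ → ℂ) (hg : MemLp g ∞ volume) : L2R →L[ℂ] L2R :=
  (ContinuousLinearMap.mul ℂ ℂ).holderL volume ∞ 2 2 hg.toLp

/-- `g(Q)` is pointwise multiplication by `g`. -/
theorem funQ_coeFn (g : ℝ → ℂ) (hg : MemLp g ∞ volume) (ψ : L2R) :
    funQ g hg ψ =ᵐ[volume] fun x => g x * ψ x := by
  have h := (ContinuousLinearMap.mul ℂ ℂ).coeFn_holder (r := 2) hg.toLp ψ
  filter_upwards [h, hg.coeFn_toLp] with x hx hgx
  rw [← hgx]
  exact hx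

/-- The bounded operator `f(P)` on `L²(ℝ)`, for `f ∈ L^∞(ℝ)`, where `P = -i d/dx`.
The unitary Fourier transform `𝓕` of `L²(ℝ)` used here extends
`ψ ↦ ∫ x, exp (-2πi x ξ) ψ(x) dx`, and hence diagonalizes `P` as multiplication by `2πξ`;
therefore `f(P) = 𝓕⁻¹ ∘ (multiplication by f(2πξ)) ∘ 𝓕`. -/
def funP (f : ℝ → ℂ) (hf : MemLp f ∞ volume) : L2R →L[ℂ] L2R :=
  ((Lp.fourierTransformₗᵢ ℝ ℂ).symm.toContinuousLinearEquiv : L2R →L[ℂ] L2R) ∘L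
    funQ (fun ξ => f (2 * Real.pi * ξ)) (memLp_top_comp_two_pi_mul hf) ∘L
    ((Lp.fourierTransformₗᵢ ℝ ℂ).toContinuousLinearEquiv : L2R →L[ℂ] L2R)

/-- `f` is almost everywhere equal to a constant. -/
def IsAEConst {β : Type*} (f : ℝ → β) : Prop :=
  ∃ c : β, f =ᵐ[volume] fun _ => c

/-- `f` has a version (a function equal to it almost everywhere) that is periodic with
period `τ`. The period need not be the smallest one. -/
def HasPeriodicVersion {β : Type*} (f : ℝ → β) (τ : ℝ) : Prop :=
  ∃ f' : ℝ → β, f' =ᵐ[volume] f ∧ Function.Periodic f' τ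

end

/-! Only if. Put F(ξ) = f(2πξ). Testing the commutator on Schwartz functions p, ψ gives ∫ F ·
`commSymbol g p ψ` = 0, and this symbol is the Fourier transform of corr p (gψ) − corr (gp) ψ.
Opposite modulations of p and ψ translate the symbol, so averaging over them multiplies that
function by an arbitrary test function h. If ψ = 1 on a large enough interval, it becomes on the
support of h the increment ∫ p(y)(g(y+t) − g(y)) dy (`integral_mul_fourier_corr_sub`). Hence the
distribution F̂ lives on the periods of g. Support alone would still allow derivatives of point
masses, but for nonconstant g some increment has a simple zero at each period, so F̂ is annihilated
by every smooth m vanishing on the periods (`integral_mul_fourier_eq_zero_of_periods`). With m(t) =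
exp(2πiat) − 1, F has period a whenever this character is trivial on the periods of g. These form a
group that is dense (g constant), trivial (f constant), or τℤ with τ ≠ 0 (a = 1/|τ|, so f has period
2π/|τ|).

If. A character exp(2πinx/τg) of Q shifts momentum by nτf, hence commutes with f(P). For a fixed
operator A the matrix elements of [A, g(Q)] are ∫ g w with w in L¹, so their vanishing passes from
characters to continuous functions on the circle by density, and then to bounded periodic functions
by a monotone class argument. -/

/-! ### Test functions, localization and Hadamard's lemma -/

section TestFunctions

open scoped ContDiff Manifold Convolution

/-- A smooth compactly supported function on the line. -/
structure IsTest (h : ℝ → ℂ) : Prop where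
  contDiff : ContDiff ℝ ∞ h
  hasCompactSupport : HasCompactSupport h

namespace IsTest

variable {h k : ℝ → ℂ}

theorem zero : IsTest (0 : ℝ → ℂ) := ⟨contDiff_const, HasCompactSupport.zero⟩

theorem add (hh : IsTest h) (hk : IsTest k) : IsTest (h + k) :=
  ⟨hh.1.add hk.1, hh.2.add hk.2⟩

theorem sum {ι : Type*} (s : Finset ι) {h : ι → ℝ → ℂ} (hh : ∀ i ∈ s, IsTest (h i)) :
    IsTest (∑ i ∈ s, h i) := by
  classical
  induction s using Finset.induction_on with
  | empty => simpa using zero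
  | insert a s ha ih =>
    rw [Finset.sum_insert ha]
    exact (hh a (by simp)).add (ih fun i hi => hh i (by simp [hi]))

theorem mul_left {q : ℝ → ℂ} (hq : ContDiff ℝ ∞ q) (hh : IsTest h) :
    IsTest (fun t => q t * h t) :=
  ⟨hq.mul hh.1, hh.2.mul_left⟩

theorem mul_left_of_contDiffAt {q : ℝ → ℂ} (hq : ∀ t ∈ tsupport h, ContDiffAt ℝ ∞ q t)
    (hh : IsTest h) : IsTest (fun t => q t * h t) := by
  refine ⟨contDiff_iff_contDiffAt.2 fun t => ?_, hh.2.mul_left⟩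
  by_cases ht : t ∈ tsupport h
  · exact (hq t ht).mul hh.1.contDiffAt
  · refine (contDiffAt_const (c := (0 : ℂ))).congr_of_eventuallyEq ?_
    filter_upwards [notMem_tsupport_iff_eventuallyEq.1 ht] with x hx
    simp [hx]

theorem ofReal {r : ℝ → ℝ} (hr : ContDiff ℝ ∞ r) (hc : HasCompactSupport r) :
    IsTest (fun t => (r t : ℂ)) :=
  ⟨Complex.ofRealCLM.contDiff.comp hr, hc.comp_left (g := fun x : ℝ => (x : ℂ)) rfl⟩

theorem comp_neg (hh : IsTest h) : IsTest (fun t => h (-t)) :=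
  ⟨hh.1.comp contDiff_neg, hh.2.comp_homeomorph (Homeomorph.neg ℝ)⟩

theorem comp_sub_right (hh : IsTest h) (a : ℝ) : IsTest (fun t => h (t - a)) :=
  ⟨hh.1.comp (contDiff_id.sub contDiff_const), hh.2.comp_homeomorph (Homeomorph.subRight a)⟩

theorem deriv (hh : IsTest h) : IsTest (deriv h) :=
  ⟨hh.1.iterate_deriv 1, hh.2.deriv⟩

theorem convolution (hh : IsTest h) (hk : IsTest k) :
    IsTest (h ⋆[ContinuousLinearMap.mul ℂ ℂ] k) :=
  ⟨hk.2.contDiff_convolution_right (ContinuousLinearMap.mul ℝ ℂ)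
      hh.1.continuous.locallyIntegrable hk.1,
    hh.2.convolution (ContinuousLinearMap.mul ℝ ℂ) hk.2⟩

/-- A test function as a Schwartz function. -/
noncomputable def toSchwartz (hh : IsTest h) : SchwartzMap ℝ ℂ := hh.2.toSchwartzMap hh.1

@[simp] theorem coe_toSchwartz (hh : IsTest h) : ⇑hh.toSchwartz = h := rfl

theorem integrable (hh : IsTest h) : Integrable h := hh.toSchwartz.integrable

theorem integrable_fourier (hh : IsTest h) : Integrable (𝓕 h) := by
  have := (𝓕 hh.toSchwartz).integrable (μ := volume)
  rwa [SchwartzMap.fourier_coe] at this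

/-- A partition of unity subordinate to a finite subcover of the support reduces an additive
property to functions of small support. -/
theorem mem_of_local {P : (ℝ → ℂ) → Prop} (h0 : P 0)
    (hadd : ∀ h k, IsTest h → IsTest k → P h → P k → P (h + k))
    (hloc : ∀ t, ∃ U, IsOpen U ∧ t ∈ U ∧ ∀ h, IsTest h → tsupport h ⊆ U → P h)
    (hh : IsTest h) : P h := by
  classical
  choose U hU htU hP using hloc
  obtain ⟨s, hs⟩ := hh.2.isCompact.elim_finite_subcover U hU
    fun t _ => Set.mem_iUnion.2 ⟨t, htU t⟩
  obtain ⟨ρ, hρ⟩ := SmoothPartitionOfUnity.exists_isSubordinate 𝓘(ℝ, ℝ)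
    (isClosed_tsupport h) (fun i : s => U i) (fun i => hU i)
    (by simpa [Set.iUnion_subtype] using hs)
  have hsum : ∀ u : Finset s, ∀ k : s → ℝ → ℂ, (∀ i ∈ u, IsTest (k i)) → (∀ i ∈ u, P (k i)) →
      P (∑ i ∈ u, k i) := by
    intro u k
    induction u using Finset.induction_on with
    | empty => intros; simpa using h0
    | insert a u ha ih =>
      intro hk hPk
      rw [Finset.sum_insert ha]
      exact hadd _ _ (hk a (by simp)) (sum _ fun i hi => hk i (by simp [hi])) (hPk a (by simp))
        (ih (fun i hi => hk i (by simp [hi])) fun i hi => hPk i (by simp [hi]))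
  have hk : ∀ i : s, IsTest (fun t => ((ρ i t : ℝ) : ℂ) * h t) := fun i =>
    mul_left (Complex.ofRealCLM.contDiff.comp (ρ i).contMDiff.contDiff) hh
  have key : h = ∑ i : s, fun t => ((ρ i t : ℝ) : ℂ) * h t := by
    ext t
    rw [Finset.sum_apply, ← Finset.sum_mul]
    by_cases ht : t ∈ tsupport h
    · have := ρ.sum_eq_one ht
      rw [finsum_eq_sum_of_fintype] at this
      rw [← Complex.ofReal_sum, this, Complex.ofReal_one, one_mul]
    · rw [image_eq_zero_of_notMem_tsupport ht, mul_zero]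
  rw [key]
  refine hsum Finset.univ _ (fun i _ => hk i) fun i _ => hP i _ (hk i) ?_
  refine (tsupport_mul_subset_left.trans ?_).trans (hρ i)
  exact closure_mono fun t ht => by simpa using ht

end IsTest

/-- Hadamard's lemma: a smooth function vanishing at a point is divisible by the coordinate. -/
theorem ContDiff.exists_eq_sub_mul {G : ℝ → ℂ} (hG : ContDiff ℝ ∞ G) {t₀ : ℝ} (h0 : G t₀ = 0) :
    ∃ D : ℝ → ℂ, ContDiff ℝ ∞ D ∧ ∀ t, G t = (t - t₀ : ℝ) * D t := by
  obtain ⟨χ, hχ1, hχc, hχs⟩ : ∃ χ : ℝ → ℝ, (∀ s ∈ Set.Icc (-1 : ℝ) 1, χ s = 1) ∧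
      HasCompactSupport χ ∧ ContDiff ℝ ∞ χ := by
    let b : ContDiffBump (0 : ℝ) := ⟨1, 2, one_pos, one_lt_two⟩
    refine ⟨b, fun s hs => b.one_of_mem_closedBall ?_, b.hasCompactSupport, b.contDiff⟩
    rw [Real.closedBall_eq_Icc]; simpa [b] using hs
  have hdG : ContDiff ℝ ∞ (deriv G) := hG.iterate_deriv 1
  -- The quotient is D(t) = ∫₀¹ G′(t₀ + (t − t₀)s) ds. Writing it as a convolution with parameter t,
  -- evaluated at 0, yields smoothness in t; the convolution evaluates `g t` at −s, hence the minus
  -- sign in `g` and a cutoff equal to 1 on [−1, 1].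
  let f : ℝ → ℝ := Set.indicator (Set.Ioc 0 1) 1
  have hf : LocallyIntegrable f := by
    refine Integrable.locallyIntegrable ?_
    exact (integrable_indicator_iff measurableSet_Ioc).2 (integrableOn_const (by simp))
  let g : ℝ → ℝ → ℂ := fun p u => (χ u : ℂ) * deriv G (t₀ - (p - t₀) * u)
  have hg : ContDiff ℝ ∞ (Function.uncurry g) := by
    refine ContDiff.mul (Complex.ofRealCLM.contDiff.comp (hχs.comp contDiff_snd)) ?_
    exact hdG.comp (by fun_prop)
  have key := contDiffOn_convolution_right_with_param_comp (μ := volume) (n := (⊤ : ℕ∞))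
    (ContinuousLinearMap.lsmul ℝ ℝ : ℝ →L[ℝ] ℂ →L[ℝ] ℂ) (s := Set.univ) (v := fun _ => 0) (f := f)
    (g := g) (k := tsupport χ) contDiffOn_const isOpen_univ hχc
    (fun p x _ hx => by
      change (χ x : ℂ) * _ = 0
      rw [image_eq_zero_of_notMem_tsupport hx]; simp) hf hg.contDiffOn
  refine ⟨_, contDiffOn_univ.1 key, fun t => ?_⟩
  have e1 : (f ⋆[(ContinuousLinearMap.lsmul ℝ ℝ : ℝ →L[ℝ] ℂ →L[ℝ] ℂ), volume] g t) 0
      = ∫ s in (0 : ℝ)..1, deriv G (t₀ + (t - t₀) * s) := by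
    rw [intervalIntegral.integral_of_le zero_le_one, ← integral_indicator measurableSet_Ioc]
    refine integral_congr_ae (Filter.Eventually.of_forall fun s => ?_)
    by_cases hs : s ∈ Set.Ioc (0 : ℝ) 1
    · have : χ (-s) = 1 := hχ1 _ ⟨by linarith [hs.2], by linarith [hs.1]⟩
      simp [f, g, hs, this]
    · simp [f, hs]
  rw [e1]
  have hd : ∀ s : ℝ, HasDerivAt (fun s : ℝ => G (t₀ + (t - t₀) * s))
      ((t - t₀ : ℝ) * deriv G (t₀ + (t - t₀) * s)) s := by
    intro s
    have h1 : HasDerivAt G (deriv G (t₀ + (t - t₀) * s)) (t₀ + (t - t₀) * s) :=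
      (hG.differentiable (by simp) _).hasDerivAt
    have h2 : HasDerivAt (fun s : ℝ => t₀ + (t - t₀) * s) (t - t₀) s := by
      simpa using ((hasDerivAt_id s).const_mul (t - t₀)).const_add t₀
    have h3 := h1.scomp s h2
    rw [Complex.real_smul] at h3
    exact h3
  have := intervalIntegral.integral_eq_sub_of_hasDerivAt (a := 0) (b := 1) (fun s _ => hd s)
    (by
      refine Continuous.intervalIntegrable ?_ _ _
      have := hdG.continuous
      fun_prop)
  rw [intervalIntegral.integral_const_mul] at this
  rw [this]
  simp [h0]

end TestFunctions

/-! ### Almost everywhere invariance under translations -/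

section Translations

theorem measurePreserving_add_right' (a : ℝ) :
    MeasurePreserving (fun x : ℝ => x + a) volume volume := measurePreserving_add_right volume a

/-- By Fubini, some single x satisfies f(x + a) = f(x) for almost every a. -/
theorem isAEConst_of_forall_shift {f : ℝ → ℂ} (hf : AEStronglyMeasurable f volume)
    (h : ∀ a, (fun x => f (x + a)) =ᵐ[volume] f) : IsAEConst f := by
  obtain ⟨g, hg, hfg⟩ := hf
  have hs : ∀ a, ∀ᵐ x, g (x + a) = g x := fun a => by
    filter_upwards [h a, hfg, (measurePreserving_add_right' a).quasiMeasurePreserving.ae hfg]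
      with x h1 h2 h3
    rw [← h2, ← h3, h1]
  have hms : MeasurableSet {p : ℝ × ℝ | g (p.2 + p.1) = g p.2} :=
    measurableSet_eq_fun (hg.measurable.comp (measurable_snd.add measurable_fst))
      (hg.measurable.comp measurable_snd)
  have h1 : ∀ᵐ p : ℝ × ℝ, g (p.2 + p.1) = g p.2 :=
    (Measure.ae_prod_iff_ae_ae hms).2 (Filter.Eventually.of_forall hs)
  have h2 : ∀ᵐ p : ℝ × ℝ, g (p.1 + p.2) = g p.1 :=
    Measure.measurePreserving_swap.quasiMeasurePreserving.ae h1
  obtain ⟨x, hx⟩ := (Measure.ae_ae_of_ae_prod h2).exists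
  refine ⟨g x, hfg.trans ?_⟩
  have h3 := (measurePreserving_add_right' (-x)).quasiMeasurePreserving.ae hx
  filter_upwards [h3] with y hy
  simpa using hy

theorem shift_zsmul {β : Type*} {f : ℝ → β} {τ : ℝ}
    (h : (fun x => f (x + τ)) =ᵐ[volume] f) (n : ℤ) :
    (fun x => f (x + n * τ)) =ᵐ[volume] f := by
  have hnat : ∀ n : ℕ, (fun x => f (x + n * τ)) =ᵐ[volume] f := by
    intro n
    induction n with
    | zero => simp
    | succ n ih =>
      have := (measurePreserving_add_right' (n * τ)).quasiMeasurePreserving.ae h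
      filter_upwards [this, ih] with x h1 h2
      rw [← h2, ← h1]; push_cast; ring_nf
  obtain ⟨m, rfl | rfl⟩ := n.eq_nat_or_neg
  · exact_mod_cast hnat m
  · have := (measurePreserving_add_right' (-(m * τ))).quasiMeasurePreserving.ae (hnat m)
    filter_upwards [this] with x hx
    simpa [neg_mul] using hx.symm

theorem hasPeriodicVersion_iff {β : Type*} {f : ℝ → β} {τ : ℝ} (hτ : 0 < τ) :
    HasPeriodicVersion f τ ↔ (fun x => f (x + τ)) =ᵐ[volume] f := by
  constructor
  · rintro ⟨f', hf', hp⟩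
    filter_upwards [hf', (measurePreserving_add_right' τ).quasiMeasurePreserving.ae hf']
      with x h1 h2
    rw [← h1, ← h2, hp x]
  · intro h
    -- The version repeats the values of f on [0, τ); the countably many integer shifts share one
    -- exceptional null set.
    refine ⟨fun x => f (toIcoMod hτ 0 x), ?_, fun x => by simp⟩
    filter_upwards [ae_all_iff.2 (shift_zsmul h)] with x hx
    have := hx (-toIcoDiv hτ 0 x)
    rw [← this, toIcoMod, zsmul_eq_mul]
    congr 1
    push_cast
    ring

end Translations

/-! ### Fourier integrals and the L² Fourier transform -/

section FourierIntegrals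

theorem integral_fourier_mul_eq {u v : ℝ → ℂ} (hu : Integrable u) (hv : Integrable v) :
    ∫ ξ, 𝓕 u ξ * v ξ = ∫ x, u x * 𝓕 v x := by
  have := VectorFourier.integral_fourierIntegral_smul_eq_flip (L := innerₗ ℝ)
    Real.continuous_fourierChar (by exact continuous_inner) hu hv
  rw [flip_innerₗ] at this
  exact this

theorem continuous_fourier {u : ℝ → ℂ} (hu : Integrable u) : Continuous (𝓕 u) :=
  VectorFourier.fourierIntegral_continuous Real.continuous_fourierChar
    (by exact continuous_inner) hu

theorem norm_fourier_le (u : ℝ → ℂ) (ξ : ℝ) : ‖𝓕 u ξ‖ ≤ ∫ x, ‖u x‖ :=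
  VectorFourier.norm_fourierIntegral_le_integral_norm _ _ _ _ _

theorem integrable_mul_fourier {u v : ℝ → ℂ} (hv : Integrable v) (hu : Integrable u) :
    Integrable (fun ξ => v ξ * 𝓕 u ξ) := by
  simp_rw [mul_comm (v _)]
  exact hv.bdd_mul (continuous_fourier hu).aestronglyMeasurable
    (Filter.Eventually.of_forall (norm_fourier_le u))

theorem fourierInv_eq_fourier_comp_neg' (u : ℝ → ℂ) : 𝓕⁻ u = 𝓕 fun x => u (-x) :=
  Real.fourierInv_eq_fourier_comp_neg u

theorem conj_fourier (u : ℝ → ℂ) (ξ : ℝ) :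
    (starRingEnd ℂ) (𝓕 u ξ) = 𝓕⁻ (fun x => (starRingEnd ℂ) (u x)) ξ := by
  rw [Real.fourier_eq', Real.fourierInv_eq', ← integral_conj]
  congr with x
  simp [← Complex.exp_conj, map_ofNat]

theorem integrable_mul_of_memLp_top {g u : ℝ → ℂ} (hg : MemLp g ∞ volume) (hu : Integrable u) :
    Integrable (fun x => g x * u x) :=
  memLp_one_iff_integrable.1 ((memLp_one_iff_integrable.2 hu).mul' hg)

theorem memLp_two_mul_of_memLp_top {g u : ℝ → ℂ} (hg : MemLp g ∞ volume)
    (hu : MemLp u 2 volume) : MemLp (fun x => g x * u x) 2 volume := hu.mul' hg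

theorem integral_mul_fourierTransform (U : L2R) (θ : SchwartzMap ℝ ℂ) :
    ∫ x, θ x * Lp.fourierTransformₗᵢ ℝ ℂ U x = ∫ x, 𝓕 θ x * U x := by
  have h := Lp.fourier_toTemperedDistribution_eq U
  have h2 := congrArg (fun T : TemperedDistribution ℝ ℂ => T θ) h
  simp only [TemperedDistribution.fourier_apply, Lp.toTemperedDistribution_apply,
    smul_eq_mul] at h2
  exact h2.symm

/-- The Fourier transform on `L²` is given by the Fourier integral on `L¹ ∩ L²`. -/
theorem fourierTransform_toLp_ae_eq {u : ℝ → ℂ} (hu : Integrable u) (hu2 : MemLp u 2 volume) :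
    Lp.fourierTransformₗᵢ ℝ ℂ hu2.toLp =ᵐ[volume] 𝓕 u := by
  refine ae_eq_of_integral_contDiff_smul_eq ((Lp.memLp _).locallyIntegrable one_le_two)
    (continuous_fourier hu).locallyIntegrable fun r hr hrc => ?_
  have hT := IsTest.ofReal hr hrc
  have h1 := integral_mul_fourierTransform hu2.toLp hT.toSchwartz
  have h2 := integral_fourier_mul_eq hT.integrable hu
  simp only [IsTest.coe_toSchwartz, SchwartzMap.fourier_coe] at h1
  simp only [Complex.real_smul]
  rw [h1, ← h2]
  refine integral_congr_ae ?_
  filter_upwards [hu2.coeFn_toLp] with x hx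
  rw [hx]

end FourierIntegrals

/-! ### The commutator as a quadratic form -/

section Operators

variable {f g : ℝ → ℂ}

theorem inner_funQ (hg : MemLp g ∞ volume) (u v : L2R) :
    inner ℂ u (funQ g hg v) = ∫ x, g x * ((starRingEnd ℂ) (u x) * v x) := by
  rw [L2.inner_def]
  refine integral_congr_ae ?_
  filter_upwards [funQ_coeFn g hg v] with x hx
  rw [hx, RCLike.inner_apply]
  ring

theorem inner_funP (hf : MemLp f ∞ volume) (u v : L2R) :
    inner ℂ u (funP f hf v) = ∫ ξ, f (2 * Real.pi * ξ) *
      ((starRingEnd ℂ) (Lp.fourierTransformₗᵢ ℝ ℂ u ξ) * Lp.fourierTransformₗᵢ ℝ ℂ v ξ) := by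
  rw [← inner_funQ (memLp_top_comp_two_pi_mul hf)]
  rw [← (Lp.fourierTransformₗᵢ ℝ ℂ).inner_map_map u]
  congr 1
  exact (Lp.fourierTransformₗᵢ ℝ ℂ).apply_symm_apply _

theorem inner_toLp_funP (hf : MemLp f ∞ volume) {u v : ℝ → ℂ} (hu : Integrable u)
    (hu2 : MemLp u 2 volume) (hv : Integrable v) (hv2 : MemLp v 2 volume) :
    inner ℂ hu2.toLp (funP f hf hv2.toLp) = ∫ ξ, f (2 * Real.pi * ξ) *
      (𝓕⁻ (fun x => (starRingEnd ℂ) (u x)) ξ * 𝓕 v ξ) := by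
  rw [inner_funP]
  refine integral_congr_ae ?_
  filter_upwards [fourierTransform_toLp_ae_eq hu hu2, fourierTransform_toLp_ae_eq hv hv2]
    with ξ h1 h2
  rw [h1, h2, conj_fourier]

theorem memLp_top_conj (hg : MemLp g ∞ volume) :
    MemLp (fun x => (starRingEnd ℂ) (g x)) ∞ volume := hg.star

theorem funQ_toLp (hg : MemLp g ∞ volume) {u : ℝ → ℂ} (hu : MemLp u 2 volume) :
    funQ g hg hu.toLp = (memLp_two_mul_of_memLp_top hg hu).toLp := by
  refine Lp.ext ?_
  filter_upwards [funQ_coeFn g hg hu.toLp, hu.coeFn_toLp,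
    (memLp_two_mul_of_memLp_top hg hu).coeFn_toLp] with x h1 h2 h3
  rw [h1, h2, h3]

theorem inner_funQ_conj (hg : MemLp g ∞ volume) (u v : L2R) :
    inner ℂ (funQ _ (memLp_top_conj hg) u) v = inner ℂ u (funQ g hg v) := by
  rw [inner_funQ, L2.inner_def]
  refine integral_congr_ae ?_
  filter_upwards [funQ_coeFn _ (memLp_top_conj hg) u] with x hx
  rw [hx, RCLike.inner_apply]
  simp
  ring

/-- The density on the Fourier side of the form `⟨conj p, [f(P), g(Q)] ψ⟩` with respect to the
multiplier of `f(P)`. -/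
noncomputable def commSymbol (g p ψ : ℝ → ℂ) (ξ : ℝ) : ℂ :=
  𝓕⁻ p ξ * 𝓕 (fun x => g x * ψ x) ξ - 𝓕⁻ (fun x => g x * p x) ξ * 𝓕 ψ ξ

theorem integrable_commSymbol_terms (hg : MemLp g ∞ volume) (p ψ : SchwartzMap ℝ ℂ) :
    Integrable (fun ξ => 𝓕⁻ (p : ℝ → ℂ) ξ * 𝓕 (fun x => g x * ψ x) ξ) ∧
    Integrable (fun ξ => 𝓕⁻ (fun x => g x * p x) ξ * 𝓕 (ψ : ℝ → ℂ) ξ) := by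
  have hp : Integrable (𝓕⁻ (p : ℝ → ℂ)) := by
    rw [← SchwartzMap.fourierInv_coe]; exact (𝓕⁻ p).integrable
  have hψ : Integrable (𝓕 (ψ : ℝ → ℂ)) := by
    rw [← SchwartzMap.fourier_coe]; exact (𝓕 ψ).integrable
  refine ⟨integrable_mul_fourier hp (integrable_mul_of_memLp_top hg ψ.integrable), ?_⟩
  rw [fourierInv_eq_fourier_comp_neg']
  simp_rw [mul_comm _ (𝓕 (ψ : ℝ → ℂ) _)]
  exact integrable_mul_fourier hψ (integrable_mul_of_memLp_top hg p.integrable).comp_neg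

theorem integrable_commSymbol (hg : MemLp g ∞ volume) (p ψ : SchwartzMap ℝ ℂ) :
    Integrable (commSymbol g p ψ) :=
  (integrable_commSymbol_terms hg p ψ).1.sub (integrable_commSymbol_terms hg p ψ).2

/-- Moving g(Q) to the left argument as its adjoint leaves f(P) alone in both terms, so Plancherel
makes the form linear in the multiplier f(2πξ). -/
theorem inner_commutator (hf : MemLp f ∞ volume) (hg : MemLp g ∞ volume)
    (φ p ψ : SchwartzMap ℝ ℂ) (hp : ∀ x, p x = (starRingEnd ℂ) (φ x)) :
    inner ℂ (φ.toLp 2) (⁅funP f hf, funQ g hg⁆ (ψ.toLp 2)) =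
      ∫ ξ, f (2 * Real.pi * ξ) * commSymbol g p ψ ξ := by
  have hφ2 : MemLp φ 2 volume := φ.memLp 2
  have hψ2 : MemLp ψ 2 volume := ψ.memLp 2
  change inner ℂ hφ2.toLp (funP f hf (funQ g hg hψ2.toLp) - funQ g hg (funP f hf hψ2.toLp)) = _
  rw [inner_sub_right, ← inner_funQ_conj, funQ_toLp, funQ_toLp,
    inner_toLp_funP hf φ.integrable hφ2 (integrable_mul_of_memLp_top hg ψ.integrable),
    inner_toLp_funP hf (integrable_mul_of_memLp_top (memLp_top_conj hg) φ.integrable) _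
      ψ.integrable]
  have hp' : (fun x => (starRingEnd ℂ) (φ x)) = p := funext fun x => (hp x).symm
  have hgp : (fun x => (starRingEnd ℂ) ((starRingEnd ℂ) (g x) * φ x)) = fun x => g x * p x := by
    ext x; simp [hp]
  obtain ⟨i1, i2⟩ := integrable_commSymbol_terms hg p ψ
  have hf' := memLp_top_comp_two_pi_mul hf
  rw [hp', hgp, ← integral_sub (integrable_mul_of_memLp_top hf' i1)
    (integrable_mul_of_memLp_top hf' i2)]
  simp only [commSymbol, mul_sub]

theorem exists_conj_schwartz (φ : SchwartzMap ℝ ℂ) :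
    ∃ p : SchwartzMap ℝ ℂ, ∀ x, p x = (starRingEnd ℂ) (φ x) :=
  ⟨SchwartzMap.postcompCLM (𝕜 := ℝ) (Complex.conjCLE : ℂ →L[ℝ] ℂ) φ, fun x => by simp⟩

theorem commutator_eq_zero_iff (hf : MemLp f ∞ volume) (hg : MemLp g ∞ volume) :
    ⁅funP f hf, funQ g hg⁆ = 0 ↔
      ∀ p ψ : SchwartzMap ℝ ℂ, ∫ ξ, f (2 * Real.pi * ξ) * commSymbol g p ψ ξ = 0 := by
  constructor
  · intro h p ψ
    obtain ⟨φ, hφ⟩ := exists_conj_schwartz p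
    rw [← inner_commutator hf hg φ p ψ (fun x => by simp [hφ]), h]
    simp
  · intro h
    have hd : DenseRange (fun φ : SchwartzMap ℝ ℂ => (φ.toLp 2 : L2R)) :=
      SchwartzMap.denseRange_toLpCLM (p := 2) ENNReal.ofNat_ne_top
    refine ContinuousLinearMap.ext fun v => ?_
    refine congrFun (hd.equalizer (g := (⁅funP f hf, funQ g hg⁆ : L2R →L[ℂ] L2R))
      (h := (0 : L2R →L[ℂ] L2R)) (ContinuousLinearMap.continuous _)
      (ContinuousLinearMap.continuous _) (funext fun ψ => ?_)) v
    refine hd.eq_of_inner_right ℂ ?_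
    intro φ
    obtain ⟨p, hp⟩ := exists_conj_schwartz φ
    have := inner_commutator hf hg φ p ψ hp
    simp only [Function.comp_apply]
    rw [this, h]
    simp

end Operators

/-! ### Modulations act on the symbol by translation -/

section Modulation

open scoped ContDiff

/-- The character `t ↦ exp (2πi b t)` of the line. -/
noncomputable def realChar (b t : ℝ) : ℂ := Complex.exp (2 * Real.pi * (b * t) * Complex.I)

theorem contDiff_realChar (b : ℝ) : ContDiff ℝ ∞ (realChar b) := by
  unfold realChar
  have : ContDiff ℝ ∞ (fun t : ℝ => (t : ℂ)) := Complex.ofRealCLM.contDiff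
  fun_prop

theorem norm_realChar (b t : ℝ) : ‖realChar b t‖ = 1 := by
  have := Complex.norm_exp_ofReal_mul_I (2 * Real.pi * (b * t))
  simpa [realChar] using this

theorem fourier_realChar_mul (b : ℝ) (u : ℝ → ℂ) (ξ : ℝ) :
    𝓕 (fun t => realChar b t * u t) ξ = 𝓕 u (ξ - b) := by
  rw [Real.fourier_eq', Real.fourier_eq']
  congr with t
  simp only [realChar, smul_eq_mul, ← mul_assoc, ← Complex.exp_add]
  congr 2
  simp
  ring

theorem fourierInv_realChar_mul (b : ℝ) (u : ℝ → ℂ) (ξ : ℝ) :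
    𝓕⁻ (fun t => realChar b t * u t) ξ = 𝓕⁻ u (ξ + b) := by
  rw [Real.fourierInv_eq_fourier_neg, fourier_realChar_mul, Real.fourierInv_eq_fourier_neg]
  ring_nf

theorem IsTest.realChar_mul {h : ℝ → ℂ} (hh : IsTest h) (b : ℝ) :
    IsTest (fun t => realChar b t * h t) := hh.mul_left (contDiff_realChar b)

theorem memLp_top_realChar (b : ℝ) : MemLp (realChar b) ∞ volume :=
  memLp_top_of_bound (contDiff_realChar b).continuous.aestronglyMeasurable 1
    (Filter.Eventually.of_forall fun t => (norm_realChar b t).le)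

/-- The modulations are opposite because p enters through the inverse transform and ψ through the
direct one. -/
theorem commSymbol_modulate (g p ψ : ℝ → ℂ) (b ξ : ℝ) :
    commSymbol g (fun t => realChar (-b) t * p t) (fun t => realChar b t * ψ t) ξ =
      commSymbol g p ψ (ξ - b) := by
  simp only [commSymbol, mul_left_comm (g _), fourier_realChar_mul, fourierInv_realChar_mul,
    ← sub_eq_add_neg]

end Modulation

/-! ### Correlations and increments of a bounded function -/

section Correlation

open scoped Convolution ContDiff

/-- The correlation `t ↦ ∫ y, u y * v (y + t)` of two functions. -/
noncomputable def corr (u v : ℝ → ℂ) (t : ℝ) : ℂ := ∫ y, u y * v (y + t)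

theorem corr_eq_convolution (u v : ℝ → ℂ) :
    corr u v = (fun y => u (-y)) ⋆[ContinuousLinearMap.mul ℂ ℂ] v := by
  ext t
  rw [corr, convolution_def, ← integral_neg_eq_self]
  simp [sub_eq_neg_add]

theorem integrable_corr {u v : ℝ → ℂ} (hu : Integrable u) (hv : Integrable v) :
    Integrable (corr u v) := by
  rw [corr_eq_convolution]
  exact hu.comp_neg.integrable_convolution _ hv

theorem fourier_corr {u v : ℝ → ℂ} (hu : Integrable u) (hv : Integrable v) (ξ : ℝ) :
    𝓕 (corr u v) ξ = 𝓕⁻ u ξ * 𝓕 v ξ := by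
  rw [corr_eq_convolution, Real.fourier_mul_convolution_eq hu.comp_neg hv,
    fourierInv_eq_fourier_comp_neg']

variable {g p : ℝ → ℂ}

theorem locallyIntegrable_of_memLp_top (hg : MemLp g ∞ volume) : LocallyIntegrable g :=
  hg.locallyIntegrable le_top

theorem contDiff_corr (hp : IsTest p) (hg : MemLp g ∞ volume) : ContDiff ℝ ∞ (corr p g) := by
  rw [corr_eq_convolution]
  exact hp.comp_neg.2.contDiff_convolution_left (ContinuousLinearMap.mul ℝ ℂ) hp.comp_neg.1
    (locallyIntegrable_of_memLp_top hg)

theorem hasDerivAt_corr (hp : IsTest p) (hg : MemLp g ∞ volume) (t : ℝ) :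
    HasDerivAt (corr p g) (-corr (deriv p) g t) t := by
  have h := hp.comp_neg.2.hasDerivAt_convolution_left (ContinuousLinearMap.mul ℝ ℂ)
    (hp.comp_neg.1.of_le (by simp)) (locallyIntegrable_of_memLp_top hg) t
  have e : ((deriv fun y => p (-y)) ⋆[ContinuousLinearMap.mul ℝ ℂ] g) t =
      -corr (deriv p) g t := by
    rw [corr_eq_convolution, convolution_def, convolution_def, ← integral_neg]
    congr with y
    rw [deriv_comp_neg]
    simp
  rw [e] at h
  rw [corr_eq_convolution p]
  exact h

theorem corr_comp_sub (u v : ℝ → ℂ) (s t : ℝ) :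
    corr (fun y => u (y - s)) v t = corr u v (t + s) := by
  rw [corr, ← integral_add_right_eq_self _ s, corr]
  congr with y
  rw [add_sub_cancel_right]
  ring_nf

theorem memLp_top_comp_add_right (hg : MemLp g ∞ volume) (t : ℝ) :
    MemLp (fun y => g (y + t)) ∞ volume :=
  hg.comp_measurePreserving (measurePreserving_add_right volume t)

/-- This turns the almost everywhere periods of g into the common zeros of the smooth functions t ↦
corr p g t − corr p g 0. -/
theorem shift_ae_eq_iff_corr (hg : MemLp g ∞ volume) (t : ℝ) :
    (fun x => g (x + t)) =ᵐ[volume] g ↔ ∀ p, IsTest p → corr p g t = corr p g 0 := by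
  constructor
  · intro h p _
    refine integral_congr_ae ?_
    filter_upwards [h] with x hx
    rw [hx, add_zero]
  · intro h
    refine ae_eq_of_integral_contDiff_smul_eq
      (locallyIntegrable_of_memLp_top (memLp_top_comp_add_right hg t))
      (locallyIntegrable_of_memLp_top hg) fun r hr hrc => ?_
    simpa [corr] using h _ (IsTest.ofReal hr hrc)

/-- A bounded function with vanishing weak derivative is almost everywhere constant. -/
theorem isAEConst_of_corr_deriv_eq_zero (hg : MemLp g ∞ volume)
    (h : ∀ p, IsTest p → corr (deriv p) g 0 = 0) : IsAEConst g := by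
  refine isAEConst_of_forall_shift hg.1 fun t => (shift_ae_eq_iff_corr hg t).2 fun p hp => ?_
  refine is_const_of_deriv_eq_zero (fun s => (hasDerivAt_corr hp hg s).differentiableAt)
    (fun s => ?_) t 0
  rw [(hasDerivAt_corr hp hg s).deriv, neg_eq_zero, ← h _ (hp.comp_sub_right s)]
  have : deriv (fun y => p (y - s)) = fun y => deriv p (y - s) :=
    funext fun y => deriv_comp_sub_const ..
  rw [this, corr_comp_sub, zero_add]

end Correlation

/-! ### The Fourier transform of f lives on the periods of g -/

section Commutation

open scoped ContDiff

variable {f g : ℝ → ℂ}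

/-- Averaging a modulation-invariant family of vanishing integrals. -/
theorem integral_mul_fourier_mul_eq_zero {F R h : ℝ → ℂ} (hF : MemLp F ∞ volume)
    (hR : Integrable R) (hS : Integrable (𝓕 R)) (h0 : ∀ b, ∫ ξ, F ξ * 𝓕 R (ξ - b) = 0)
    (hh : IsTest h) : ∫ ξ, F ξ * 𝓕 (fun t => R t * h t) ξ = 0 := by
  let k : SchwartzMap ℝ ℂ := 𝓕⁻ hh.toSchwartz
  have hk : 𝓕 (k : ℝ → ℂ) = h := by
    rw [← SchwartzMap.fourier_coe, FourierTransform.fourier_fourierInv_eq]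
    rfl
  have hkn : Integrable (fun b => k (-b)) := k.integrable.comp_neg
  -- Since h = 𝓕 k, multiplication by h averages the translates of 𝓕 R with the integrable weight
  -- k(−b); Fubini then leaves the integrals in `h0`.
  have e1 : ∀ ξ, 𝓕 (fun t => R t * h t) ξ = ∫ b, k (-b) * 𝓕 R (ξ - b) := by
    intro ξ
    have hRi : Integrable (fun t => realChar (-ξ) t * R t) :=
      integrable_mul_of_memLp_top (memLp_top_realChar _) hR
    have := integral_fourier_mul_eq hRi k.integrable
    rw [hk] at this
    simp only [fourier_realChar_mul] at this
    rw [← integral_neg_eq_self]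
    simp only [neg_neg]
    calc _ = ∫ x, realChar (-ξ) x * R x * h x := by
          rw [Real.fourier_eq']
          congr with t
          simp only [realChar, smul_eq_mul, mul_assoc]
          congr 2
          simp
          ring
      _ = _ := by
          rw [← this]
          congr with b
          rw [mul_comm]
          congr 2
          ring_nf
  simp_rw [e1, ← integral_const_mul]
  have hprod : Integrable (fun q : ℝ × ℝ => F q.1 * (k (-q.2) * 𝓕 R (q.1 - q.2)))
      (volume.prod volume) := by
    have h1 := hkn.convolution_integrand (ContinuousLinearMap.mul ℂ ℂ) hS
    have hF1 : MemLp (fun q : ℝ × ℝ => F q.1) ∞ (volume.prod volume) := by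
      refine ⟨hF.1.comp_fst, lt_of_le_of_lt ?_ hF.2⟩
      rw [eLpNorm_exponent_top, eLpNorm_exponent_top]
      refine essSup_le_of_ae_le _ ?_
      exact Measure.quasiMeasurePreserving_fst.ae
        (ae_le_essSup (f := fun x => ‖F x‖ₑ) (μ := (volume : Measure ℝ)))
    exact memLp_one_iff_integrable.1 ((memLp_one_iff_integrable.2 h1).mul' hF1)
  rw [integral_integral_swap hprod]
  simp_rw [mul_left_comm (F _), integral_const_mul, h0]
  simp

/-- If `f(P)` and `g(Q)` commute, then the Fourier transform of `f`, as a distribution, is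
annihilated by the increments `t ↦ ∫ y, p y * (g (y + t) - g y)` of `g`. -/
theorem integral_mul_fourier_corr_sub (hf : MemLp f ∞ volume) (hg : MemLp g ∞ volume)
    (hcomm : ⁅funP f hf, funQ g hg⁆ = 0) {p h : ℝ → ℂ} (hp : IsTest p) (hh : IsTest h) :
    ∫ ξ, f (2 * Real.pi * ξ) * 𝓕 (fun t => (corr p g t - corr p g 0) * h t) ξ = 0 := by
  obtain ⟨r₁, hr₁⟩ := hp.2.isCompact.isBounded.subset_closedBall 0
  obtain ⟨r₂, hr₂⟩ := hh.2.isCompact.isBounded.subset_closedBall 0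
  obtain ⟨ψ, hψ, hψ1⟩ : ∃ ψ : ℝ → ℂ, IsTest ψ ∧ ∀ x, |x| ≤ r₁ + r₂ → ψ x = 1 := by
    let b : ContDiffBump (0 : ℝ) := ⟨|r₁ + r₂| + 1, |r₁ + r₂| + 2, by positivity, by linarith⟩
    refine ⟨_, IsTest.ofReal b.contDiff b.hasCompactSupport, fun x hx => ?_⟩
    rw [b.one_of_mem_closedBall, Complex.ofReal_one]
    rw [mem_closedBall_zero_iff, Real.norm_eq_abs]
    exact (hx.trans (le_abs_self _)).trans (by simp [b])
  have hgψ := integrable_mul_of_memLp_top hg hψ.integrable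
  have hgp := integrable_mul_of_memLp_top hg hp.integrable
  let R : ℝ → ℂ := corr p (fun x => g x * ψ x) - corr (fun x => g x * p x) ψ
  have i1 := integrable_corr hp.integrable hgψ
  have i2 := integrable_corr hgp hψ.integrable
  have hFR : 𝓕 R = commSymbol g p ψ := by
    ext ξ
    rw [commSymbol, ← fourier_corr hp.integrable hgψ, ← fourier_corr hgp hψ.integrable,
      Real.fourier_eq, Real.fourier_eq, Real.fourier_eq, ← integral_sub]
    · simp [R, smul_sub]
    · exact (Real.fourierIntegral_convergent_iff ξ).2 i1
    · exact (Real.fourierIntegral_convergent_iff ξ).2 i2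
  have hzero : ∀ b, ∫ ξ, f (2 * Real.pi * ξ) * 𝓕 R (ξ - b) = 0 := by
    intro b
    have := (commutator_eq_zero_iff hf hg).1 hcomm (hp.realChar_mul (-b)).toSchwartz
      (hψ.realChar_mul b).toSchwartz
    simpa only [IsTest.coe_toSchwartz, commSymbol_modulate, hFR] using this
  have key := integral_mul_fourier_mul_eq_zero (memLp_top_comp_two_pi_mul hf) (i1.sub i2)
    (by rw [hFR]; exact integrable_commSymbol hg hp.toSchwartz hψ.toSchwartz) hzero hh
  rw [← key]
  refine integral_congr_ae (Filter.Eventually.of_forall fun ξ =>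
    congrArg (fun k : ℝ → ℂ => f (2 * Real.pi * ξ) * 𝓕 k ξ) (funext fun t => ?_))
  by_cases ht : h t = 0
  · simp [ht]
  congr 1
  -- For t in the support of h and y in that of p, the point y + t lies where ψ = 1, so the cutoff
  -- disappears and R(t) is the increment.
  have ht2 : |t| ≤ r₂ := by simpa using hr₂ (subset_tsupport h ht)
  have hy : ∀ y, p y ≠ 0 → ψ (y + t) = 1 := fun y hy => hψ1 _ <| by
    have : |y| ≤ r₁ := by simpa using hr₁ (subset_tsupport p hy)
    exact (abs_add_le y t).trans (add_le_add this ht2)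
  simp only [corr, Pi.sub_apply, add_zero]
  congr 1 <;> congr with y <;> by_cases hpy : p y = 0 <;> simp [hpy, hy, mul_comm]

/-- Localization: if every increment of a non-constant `g` annihilates the Fourier transform of
`F`, then so does every smooth function vanishing on the periods of `g`. -/
theorem integral_mul_fourier_eq_zero_of_periods {F : ℝ → ℂ} (hF : MemLp F ∞ volume)
    (hg : MemLp g ∞ volume) (hgc : ¬ IsAEConst g)
    (hann : ∀ p h, IsTest p → IsTest h →
      ∫ ξ, F ξ * 𝓕 (fun t => (corr p g t - corr p g 0) * h t) ξ = 0)
    {m : ℝ → ℂ} (hm : ContDiff ℝ ∞ m)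
    (hm0 : ∀ t, (fun x => g (x + t)) =ᵐ[volume] g → m t = 0) {h : ℝ → ℂ} (hh : IsTest h) :
    ∫ ξ, F ξ * 𝓕 (fun t => m t * h t) ξ = 0 := by
  refine IsTest.mem_of_local (P := fun h => ∫ ξ, F ξ * 𝓕 (fun t => m t * h t) ξ = 0) ?_ ?_ ?_ hh
  · simp [Real.fourier_eq]
  · intro h k hh hk h1 h2
    have hh' := hh.mul_left hm
    have hk' := hk.mul_left hm
    have e : ∀ ξ, 𝓕 (fun t => m t * (h + k) t) ξ =
        𝓕 (fun t => m t * h t) ξ + 𝓕 (fun t => m t * k t) ξ := fun ξ => by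
      rw [Real.fourier_eq, Real.fourier_eq, Real.fourier_eq, ← integral_add]
      · simp [mul_add]
      · exact (Real.fourierIntegral_convergent_iff ξ).2 hh'.integrable
      · exact (Real.fourierIntegral_convergent_iff ξ).2 hk'.integrable
    simp_rw [e, mul_add]
    rw [integral_add (integrable_mul_of_memLp_top hF hh'.integrable_fourier)
      (integrable_mul_of_memLp_top hF hk'.integrable_fourier), h1, h2, add_zero]
  · intro t₀
    obtain ⟨p, D, E, hp, hD, hE, hDt, hfac⟩ : ∃ p D E : ℝ → ℂ, IsTest p ∧ ContDiff ℝ ∞ D ∧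
        ContDiff ℝ ∞ E ∧ D t₀ ≠ 0 ∧ ∀ t, D t * m t = (corr p g t - corr p g 0) * E t := by
      by_cases ht₀ : (fun x => g (x + t₀)) =ᵐ[volume] g
      -- At a period the increment must have a simple zero. Its derivative there is −corr p′ g t₀ =
      -- −corr p′ g 0, by periodicity tested on p′, and this is nonzero for some p since g is not
      -- constant. Dividing the increment and m by t − t₀ gives D and E.
      · obtain ⟨p, hp, hpg⟩ : ∃ p, IsTest p ∧ corr (deriv p) g 0 ≠ 0 := by
          by_contra! hcon
          exact hgc (isAEConst_of_corr_deriv_eq_zero hg hcon)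
        have hG : ContDiff ℝ ∞ (fun t => corr p g t - corr p g 0) :=
          (contDiff_corr hp hg).sub contDiff_const
        obtain ⟨D, hD, hDG⟩ := hG.exists_eq_sub_mul (t₀ := t₀)
          (sub_eq_zero.2 ((shift_ae_eq_iff_corr hg t₀).1 ht₀ p hp))
        obtain ⟨E, hE, hEm⟩ := hm.exists_eq_sub_mul (hm0 t₀ ht₀)
        refine ⟨p, D, E, hp, hD, hE, ?_, fun t => by rw [hDG, hEm]; ring⟩
        have d1 : HasDerivAt (fun t => corr p g t - corr p g 0) (-corr (deriv p) g t₀) t₀ :=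
          (hasDerivAt_corr hp hg t₀).sub_const _
        have d2 : HasDerivAt (fun t : ℝ => ((t - t₀ : ℝ) : ℂ) * D t)
            (1 * D t₀ + ((t₀ - t₀ : ℝ) : ℂ) * deriv D t₀) t₀ :=
          (((hasDerivAt_id t₀).sub_const t₀).ofReal_comp).mul
            ((hD.differentiable (by simp) t₀).hasDerivAt)
        rw [← funext hDG] at d2
        have := d1.unique d2
        rw [(shift_ae_eq_iff_corr hg t₀).1 ht₀ _ hp.deriv] at this
        simp only [sub_self, Complex.ofReal_zero, zero_mul, add_zero, one_mul] at this
        rw [← this]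
        simpa using hpg
      · rw [shift_ae_eq_iff_corr hg] at ht₀
        push Not at ht₀
        obtain ⟨p, hp, hpt⟩ := ht₀
        exact ⟨p, fun t => corr p g t - corr p g 0, m, hp,
          (contDiff_corr hp hg).sub contDiff_const, hm, sub_ne_zero.2 hpt, fun t => rfl⟩
    refine ⟨{t | D t ≠ 0}, hD.continuous.isOpen_preimage _ isOpen_ne, hDt, fun h hh hU => ?_⟩
    -- On the support of h, m is E/D times the increment, so (E/D)h is the test function to use in
    -- `hann`.
    have hq : IsTest (fun t => (E t * (D t)⁻¹) * h t) :=
      hh.mul_left_of_contDiffAt fun t ht => hE.contDiffAt.mul (hD.contDiffAt.inv (hU ht))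
    rw [← hann p _ hp hq]
    refine integral_congr_ae (Filter.Eventually.of_forall fun ξ =>
      congrArg (fun k : ℝ → ℂ => F ξ * 𝓕 k ξ) (funext fun t => ?_))
    by_cases ht : h t = 0
    · simp [ht]
    · have hDt : D t ≠ 0 := hU (subset_tsupport h ht)
      have := hfac t
      field_simp
      linear_combination this

/-- A bounded function is zero if its Fourier transform vanishes as a distribution. -/
theorem ae_eq_zero_of_integral_mul_fourier {u : ℝ → ℂ} (hu : MemLp u ∞ volume)
    (h0 : ∀ h, IsTest h → ∫ ξ, u ξ * 𝓕 h ξ = 0) : u =ᵐ[volume] 0 := by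
  -- The product u · 𝓕 k is in L², where the transform is injective; pairing its transform with a
  -- test function T amounts to pairing u with 𝓕 (k ⋆ T).
  have hk0 : ∀ k, IsTest k → ∀ᵐ ξ, u ξ * 𝓕 k ξ = 0 := by
    intro k hk
    have hk2 : MemLp (𝓕 k) 2 volume := by
      have := (𝓕 hk.toSchwartz).memLp 2 volume
      rwa [SchwartzMap.fourier_coe] at this
    have hw := memLp_two_mul_of_memLp_top hu hk2
    have hU : ∀ᵐ x, Lp.fourierTransformₗᵢ ℝ ℂ hw.toLp x = 0 := by
      refine ae_eq_zero_of_integral_contDiff_smul_eq_zero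
        ((Lp.memLp _).locallyIntegrable one_le_two) fun r hr hrc => ?_
      have hT := IsTest.ofReal hr hrc
      have h1 := integral_mul_fourierTransform hw.toLp hT.toSchwartz
      simp only [IsTest.coe_toSchwartz, SchwartzMap.fourier_coe] at h1
      simp only [Complex.real_smul]
      rw [h1, ← h0 _ (hk.convolution hT)]
      refine integral_congr_ae ?_
      filter_upwards [hw.coeFn_toLp] with ξ hξ
      rw [hξ, Real.fourier_mul_convolution_eq hk.integrable hT.integrable]
      ring
    have hU0 : (Lp.fourierTransformₗᵢ ℝ ℂ hw.toLp) = 0 := (Lp.eq_zero_iff_ae_eq_zero).2 hU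
    rw [LinearIsometryEquiv.map_eq_zero_iff, Lp.eq_zero_iff_ae_eq_zero] at hU0
    filter_upwards [hw.coeFn_toLp, hU0] with ξ h1 h2
    rw [← h1, h2]; rfl
  have hnull : volume {ξ | ¬ u ξ = 0} = 0 := by
    refine measure_null_of_locally_null _ fun b _ => ?_
    -- A bump modulated by b has transform at b equal to its integral, which is positive.
    obtain ⟨k, hk, hkb⟩ : ∃ k, IsTest k ∧ 𝓕 k b ≠ 0 := by
      let β : ContDiffBump (0 : ℝ) := ⟨1, 2, one_pos, one_lt_two⟩
      refine ⟨_, (IsTest.ofReal β.contDiff β.hasCompactSupport).realChar_mul b, ?_⟩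
      rw [fourier_realChar_mul, sub_self, Real.fourier_eq]
      have : 0 < ∫ x, β x := β.integral_pos
      simpa [integral_complex_ofReal] using this.ne'
    refine ⟨{ξ | ¬ u ξ = 0} ∩ {ξ | 𝓕 k ξ ≠ 0}, Filter.inter_mem self_mem_nhdsWithin
      (mem_nhdsWithin_of_mem_nhds ?_), ?_⟩
    · exact ((continuous_fourier hk.integrable).isOpen_preimage _ isOpen_ne).mem_nhds hkb
    · refine measure_mono_null (fun ξ hξ => ?_) (ae_iff.1 (hk0 k hk))
      exact mul_ne_zero hξ.1 hξ.2
  exact ae_iff.2 hnull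

/-! ### Period groups and the direct implication -/

theorem shift_ae_eq_of_realChar_sub_one {F : ℝ → ℂ} (hF : MemLp F ∞ volume) (a : ℝ)
    (h0 : ∀ h, IsTest h → ∫ ξ, F ξ * 𝓕 (fun t => (realChar a t - 1) * h t) ξ = 0) :
    (fun ξ => F (ξ + a)) =ᵐ[volume] F := by
  have := ae_eq_zero_of_integral_mul_fourier ((memLp_top_comp_add_right hF a).sub hF) fun h hh => by
    rw [← h0 h hh]
    have e : ∀ ξ, 𝓕 (fun t => (realChar a t - 1) * h t) ξ = 𝓕 h (ξ - a) - 𝓕 h ξ := fun ξ => by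
      rw [← fourier_realChar_mul, Real.fourier_eq, Real.fourier_eq, Real.fourier_eq,
        ← integral_sub]
      · simp [sub_mul, smul_sub]
      · exact (Real.fourierIntegral_convergent_iff ξ).2 (hh.realChar_mul a).integrable
      · exact (Real.fourierIntegral_convergent_iff ξ).2 hh.integrable
    simp_rw [e, mul_sub, Pi.sub_apply, sub_mul]
    rw [integral_sub, integral_sub]
    · congr 1
      rw [← integral_add_right_eq_self (fun ξ => F ξ * 𝓕 h (ξ - a)) a]
      simp
    · exact integrable_mul_of_memLp_top hF (hh.integrable_fourier.comp_sub_right a)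
    · exact integrable_mul_of_memLp_top hF hh.integrable_fourier
    · exact integrable_mul_of_memLp_top (memLp_top_comp_add_right hF a) hh.integrable_fourier
    · exact integrable_mul_of_memLp_top hF hh.integrable_fourier
  filter_upwards [this] with ξ hξ
  exact sub_eq_zero.1 hξ

theorem quasiMeasurePreserving_const_mul {c : ℝ} (hc : c ≠ 0) :
    Measure.QuasiMeasurePreserving (fun ξ : ℝ => c * ξ) volume volume := by
  refine ⟨by fun_prop, ?_⟩
  rw [Real.map_volume_mul_left hc]
  exact Measure.smul_absolutelyContinuous

theorem shift_two_pi_mul_iff {β : Type*} {f : ℝ → β} (a : ℝ) :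
    (fun ξ => f (2 * Real.pi * (ξ + a))) =ᵐ[volume] (fun ξ => f (2 * Real.pi * ξ)) ↔
      (fun x => f (x + 2 * Real.pi * a)) =ᵐ[volume] f := by
  constructor
  · intro h
    filter_upwards [(quasiMeasurePreserving_const_mul (inv_ne_zero Real.two_pi_pos.ne')).ae h] with x hx
    rwa [mul_add, mul_inv_cancel_left₀ Real.two_pi_pos.ne'] at hx
  · intro h
    filter_upwards [(quasiMeasurePreserving_const_mul Real.two_pi_pos.ne').ae h] with x hx
    rw [mul_add, hx]

/-- The subgroup of almost everywhere periods of a function. -/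
def aePeriods (g : ℝ → ℂ) : AddSubgroup ℝ where
  carrier := {t | (fun x => g (x + t)) =ᵐ[volume] g}
  zero_mem' := by simp
  add_mem' := by
    intro s t hs ht
    filter_upwards [hs, (measurePreserving_add_right' s).quasiMeasurePreserving.ae ht]
      with x h1 h2
    rw [← h1, ← h2, add_assoc]
  neg_mem' := by
    intro t ht
    filter_upwards [(measurePreserving_add_right' (-t)).quasiMeasurePreserving.ae ht] with x h1
    rw [← h1, neg_add_cancel_right]

theorem mem_aePeriods {g : ℝ → ℂ} {t : ℝ} :
    t ∈ aePeriods g ↔ (fun x => g (x + t)) =ᵐ[volume] g := Iff.rfl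

/-- The correlations are continuous in t and constant on the periods, hence constant. -/
theorem isAEConst_of_dense_aePeriods (hg : MemLp g ∞ volume)
    (hd : Dense (aePeriods g : Set ℝ)) : IsAEConst g := by
  refine isAEConst_of_forall_shift hg.1 fun t => (shift_ae_eq_iff_corr hg t).2 fun p hp => ?_
  exact congrFun ((contDiff_corr hp hg).continuous.ext_on hd continuous_const
    fun s hs => (shift_ae_eq_iff_corr hg s).1 hs p hp) t

theorem const_or_periodic_of_commute (hf : MemLp f ∞ volume) (hg : MemLp g ∞ volume)
    (hcomm : ⁅funP f hf, funQ g hg⁆ = 0) :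
    (IsAEConst f ∨ IsAEConst g) ∨ ∃ τf τg : ℝ, 0 < τf ∧ 0 < τg ∧ τf * τg = 2 * Real.pi ∧
      HasPeriodicVersion f τf ∧ HasPeriodicVersion g τg := by
  by_cases hgc : IsAEConst g
  · exact Or.inl (Or.inr hgc)
  have hF := memLp_top_comp_two_pi_mul hf
  have hshift : ∀ a : ℝ, (∀ t ∈ aePeriods g, realChar a t = 1) →
      (fun x => f (x + 2 * Real.pi * a)) =ᵐ[volume] f := fun a ha =>
    (shift_two_pi_mul_iff a).1 <| shift_ae_eq_of_realChar_sub_one hF a fun h hh =>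
      integral_mul_fourier_eq_zero_of_periods hF hg hgc
        (fun p h hp hh => integral_mul_fourier_corr_sub hf hg hcomm hp hh)
        ((contDiff_realChar a).sub contDiff_const)
        (fun t ht => sub_eq_zero.2 (ha t ht)) hh
  obtain hd | ⟨τ, hτ⟩ := (aePeriods g).dense_or_cyclic
  · exact absurd (isAEConst_of_dense_aePeriods hg hd) hgc
  have hmem : ∀ t, t ∈ aePeriods g ↔ ∃ n : ℤ, n • τ = t := fun t => by
    rw [hτ, AddSubgroup.mem_closure_singleton]
  by_cases h0 : τ = 0
  · refine Or.inl (Or.inl (isAEConst_of_forall_shift hf.1 fun a => ?_))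
    have := hshift (a / (2 * Real.pi)) fun t ht => by
      obtain ⟨n, rfl⟩ := (hmem t).1 ht
      simp [h0, realChar]
    rwa [mul_div_cancel₀ _ Real.two_pi_pos.ne'] at this
  · have hpos : 0 < |τ| := abs_pos.2 h0
    -- Taking a = |τ|⁻¹ makes the character trivial on τℤ; the absolute value is needed since the
    -- generator may be negative.
    refine Or.inr ⟨2 * Real.pi * |τ|⁻¹, |τ|, ?_, hpos, ?_, ?_, ?_⟩
    · positivity
    · field_simp
    · refine (hasPeriodicVersion_iff ?_).2 (hshift _ fun t ht => ?_)
      · positivity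
      · obtain ⟨n, rfl⟩ := (hmem t).1 ht
        have hτC : (τ : ℂ) ≠ 0 := Complex.ofReal_ne_zero.2 h0
        rw [realChar, Complex.exp_eq_one_iff]
        obtain h | h := abs_choice τ
        · exact ⟨n, by rw [h]; push_cast [zsmul_eq_mul]; field_simp⟩
        · exact ⟨-n, by rw [h]; push_cast [zsmul_eq_mul]; field_simp⟩
    · refine (hasPeriodicVersion_iff hpos).2 (mem_aePeriods.1 ?_)
      obtain h | h := abs_choice τ
      · exact (hmem _).2 ⟨1, by simp [h]⟩
      · exact (hmem _).2 ⟨-1, by simp [h]⟩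

end Commutation

/-! ### From continuous to bounded measurable functions -/

section BoundedMeasurable

open Filter Topology

variable {X : Type*} [PseudoEMetricSpace X] [MeasurableSpace X] [BorelSpace X]
  {Ω : Type*} [MeasurableSpace Ω] {μ : Measure Ω} {π : Ω → X} {w : Ω → ℂ}

/-- A complex density annihilating all continuous functions of a map `π` has vanishing integral
over the preimages under `π` of measurable sets. -/
theorem setIntegral_preimage_eq_zero_of_continuous (hπ : Measurable π) (hw : Integrable w μ)
    (h0 : ∀ c : X → ℂ, Continuous c → ∫ x, c (π x) * w x ∂μ = 0) {s : Set X}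
    (hs : MeasurableSet s) : ∫ x in π ⁻¹' s, w x ∂μ = 0 := by
  have huniv : ∫ x, w x ∂μ = 0 := by simpa using h0 (fun _ => 1) continuous_const
  -- Closed sets form a π-system generating the Borel sets, and their indicators are bounded
  -- pointwise limits of continuous functions.
  induction s, hs using MeasurableSpace.induction_on_inter
    ((BorelSpace.measurable_eq (α := X)).trans borel_eq_generateFrom_isClosed)
    isPiSystem_isClosed with
  | empty => simp
  | basic K hK =>
    have hK : IsClosed K := hK
    have hpos : ∀ n : ℕ, (0 : ℝ) < 1 / ((n : ℝ) + 1) := fun n => Nat.one_div_pos_of_nat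
    have hlim := thickenedIndicator_tendsto_indicator_closure hpos
      tendsto_one_div_add_atTop_nhds_zero_nat K
    rw [hK.closure_eq, tendsto_pi_nhds] at hlim
    let c : ℕ → X → ℂ := fun n x => ((thickenedIndicator (hpos n) K x : ℝ) : ℂ)
    have hc : ∀ n, Continuous (c n) := fun n =>
      Complex.continuous_ofReal.comp (NNReal.continuous_coe.comp (thickenedIndicator _ K).continuous)
    have key : Tendsto (fun n => ∫ x, c n (π x) * w x ∂μ) atTop
        (𝓝 (∫ x, (π ⁻¹' K).indicator w x ∂μ)) := by
      refine tendsto_integral_of_dominated_convergence (fun x => ‖w x‖)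
        (fun n => ((hc n).measurable.comp hπ).aestronglyMeasurable.mul hw.1) hw.norm
        (fun n => Eventually.of_forall fun x => ?_) (Eventually.of_forall fun x => ?_)
      · rw [norm_mul]
        refine mul_le_of_le_one_left (norm_nonneg _) ?_
        simp only [c, Complex.norm_real, NNReal.norm_eq]
        exact_mod_cast thickenedIndicator_le_one (hpos n) K (π x)
      · have h1 : Tendsto (fun n => c n (π x)) atTop
            (𝓝 (((K.indicator (fun _ => (1 : NNReal)) (π x) : NNReal) : ℝ) : ℂ)) :=
          ((Complex.continuous_ofReal.comp NNReal.continuous_coe).tendsto _).comp (hlim (π x))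
        have h2 := h1.mul_const (w x)
        by_cases hx : π x ∈ K
        · simpa [hx] using h2
        · simpa [hx] using h2
    simp_rw [h0 _ (hc _)] at key
    rw [← integral_indicator (hπ hK.measurableSet)]
    exact tendsto_nhds_unique key tendsto_const_nhds
  | compl t ht ih =>
    rw [Set.preimage_compl, setIntegral_compl (hπ ht) hw, ih, huniv, sub_zero]
  | iUnion f hd hf ih =>
    rw [Set.preimage_iUnion, integral_iUnion (fun i => hπ (hf i))
      (fun i j hij => (hd hij).preimage π) hw.integrableOn]
    simp [ih]

theorem integral_comp_mul_eq_zero_of_continuous (hπ : Measurable π) (hw : Integrable w μ)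
    (h0 : ∀ c : X → ℂ, Continuous c → ∫ x, c (π x) * w x ∂μ = 0) {G : X → ℂ}
    (hG : Measurable G) {C : ℝ} (hC : ∀ x, ‖G x‖ ≤ C) :
    ∫ x, G (π x) * w x ∂μ = 0 := by
  have hint : ∀ s : SimpleFunc X ℂ, Integrable (fun x => s (π x) * w x) μ := fun s => by
    obtain ⟨B, hB⟩ := s.exists_forall_norm_le
    exact hw.bdd_mul (s.measurable.comp hπ).aestronglyMeasurable
      (Eventually.of_forall fun x => hB (π x))
  have hsimple : ∀ s : SimpleFunc X ℂ, ∫ x, s (π x) * w x ∂μ = 0 := fun s => by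
    induction s using SimpleFunc.induction with
    | const c hs =>
      rename_i s
      have e : ∀ x, (SimpleFunc.piecewise s hs (SimpleFunc.const X c) (SimpleFunc.const X 0))
          (π x) * w x = (π ⁻¹' s).indicator (fun x => c * w x) x := fun x => by
        by_cases hx : π x ∈ s <;> simp [hx]
      simp_rw [e]
      rw [integral_indicator (hπ hs), integral_const_mul,
        setIntegral_preimage_eq_zero_of_continuous hπ hw h0 hs, mul_zero]
    | @add f g _ hf hg =>
      simp only [SimpleFunc.coe_add, Pi.add_apply, add_mul]
      rw [integral_add (hint f) (hint g), hf, hg, add_zero]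
  have hGs := hG.stronglyMeasurable
  have key : Tendsto (fun n => ∫ x, hGs.approxBounded C n (π x) * w x ∂μ) atTop
      (𝓝 (∫ x, G (π x) * w x ∂μ)) := by
    refine tendsto_integral_of_dominated_convergence (fun x => C * ‖w x‖)
      (fun n => (hint _).1) (hw.norm.const_mul C)
      (fun n => Eventually.of_forall fun x => ?_) (Eventually.of_forall fun x => ?_)
    · rw [norm_mul]
      gcongr
      exact hGs.norm_approxBounded_le ((norm_nonneg _).trans (hC (π x))) n (π x)
    · exact (hGs.tendsto_approxBounded_of_norm_le (hC (π x))).mul_const _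
  simp_rw [hsimple] at key
  exact tendsto_nhds_unique key tendsto_const_nhds

end BoundedMeasurable

/-! ### Periodic functions as functions on the circle -/

section Periodic

variable {τ : ℝ} {w g : ℝ → ℂ}

/-- An integrable function orthogonal to all characters of period `τ` annihilates the continuous
functions of period `τ`. -/
theorem integral_continuous_circle_mul_eq_zero (hτ : 0 < τ) (hw : Integrable w)
    (h0 : ∀ n : ℤ, ∫ x, realChar (n / τ) x * w x = 0) {c : AddCircle τ → ℂ} (hc : Continuous c) :
    ∫ x : ℝ, c x * w x = 0 := by
  have : Fact (0 < τ) := ⟨hτ⟩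
  have hint : ∀ c : C(AddCircle τ, ℂ), Integrable (fun x : ℝ => c x * w x) := fun c =>
    hw.bdd_mul (c.continuous.comp (AddCircle.continuous_mk' τ)).aestronglyMeasurable
      (Filter.Eventually.of_forall fun x => c.norm_coe_le_norm x)
  let Φ : C(AddCircle τ, ℂ) →L[ℂ] ℂ := LinearMap.mkContinuous
    { toFun := fun c => ∫ x : ℝ, c x * w x
      map_add' := fun c d => by
        simp only [ContinuousMap.add_apply, add_mul]
        exact integral_add (hint c) (hint d)
      map_smul' := fun a c => by
        simp only [ContinuousMap.smul_apply, smul_eq_mul, mul_assoc, RingHom.id_apply]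
        exact integral_const_mul _ _ } (∫ x, ‖w x‖) fun c => by
    refine (norm_integral_le_of_norm_le (hw.norm.const_mul ‖c‖)
      (Filter.Eventually.of_forall fun x => ?_)).trans_eq ?_
    · rw [norm_mul]
      gcongr
      exact c.norm_coe_le_norm x
    · rw [integral_const_mul, mul_comm]
  have hle : (Submodule.span ℂ (Set.range (@fourier τ))).topologicalClosure ≤ Φ.ker := by
    refine Submodule.topologicalClosure_minimal _ (Submodule.span_le.2 ?_) Φ.isClosed_ker
    rintro _ ⟨n, rfl⟩
    change ∫ x : ℝ, fourier n (x : AddCircle τ) * w x = 0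
    rw [← h0 n]
    congr with x
    rw [fourier_coe_apply, realChar]
    congr 2
    push_cast
    ring
  rw [span_fourier_closure_eq_top] at hle
  exact hle (Submodule.mem_top (x := (⟨c, hc⟩ : C(AddCircle τ, ℂ))))

/-- An integrable function orthogonal to all characters of period `τ` annihilates the bounded
functions of period `τ`. -/
theorem integral_periodic_mul_eq_zero (hτ : 0 < τ) (hg : MemLp g ∞ volume)
    (hgτ : (fun x => g (x + τ)) =ᵐ[volume] g) (hw : Integrable w)
    (h0 : ∀ n : ℤ, ∫ x, realChar (n / τ) x * w x = 0) : ∫ x, g x * w x = 0 := by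
  have : Fact (0 < τ) := ⟨hτ⟩
  -- Descending to the circle needs a Borel version bounded at every point; truncation at the
  -- essential bound provides it.
  obtain ⟨g₁, hg₁m, C, hC, hgg₁⟩ : ∃ g₁ : ℝ → ℂ, Measurable g₁ ∧ ∃ C, (∀ x, ‖g₁ x‖ ≤ C) ∧
      g₁ =ᵐ[volume] g := by
    obtain ⟨C, hC⟩ : ∃ C : ℝ, ∀ᵐ x, ‖g x‖ ≤ C := by
      refine ⟨(eLpNorm g ∞ volume).toReal, ?_⟩
      filter_upwards [ae_le_eLpNormEssSup (f := g) (μ := volume)] with x hx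
      rw [← eLpNorm_exponent_top] at hx
      rw [← toReal_enorm]
      exact ENNReal.toReal_mono hg.2.ne hx
    refine ⟨fun x => if ‖hg.1.mk g x‖ ≤ |C| then hg.1.mk g x else 0, ?_, |C|, fun x => ?_, ?_⟩
    · have hm := hg.1.stronglyMeasurable_mk.measurable
      exact Measurable.ite (measurableSet_le hm.norm measurable_const) hm measurable_const
    · dsimp only
      split_ifs with h
      · exact h
      · simp
    · filter_upwards [hg.1.ae_eq_mk, hC] with x h1 h2
      rw [← h1, if_pos (h2.trans (le_abs_self C))]
  have hg₁τ : (fun x => g₁ (x + τ)) =ᵐ[volume] g₁ := by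
    filter_upwards [hgg₁, hgτ, (measurePreserving_add_right' τ).quasiMeasurePreserving.ae hgg₁]
      with x h1 h2 h3
    rw [h1, h3, h2]
  let G : AddCircle τ → ℂ := fun y => g₁ (AddCircle.measurableEquivIoc τ 0 y)
  have hGm : Measurable G :=
    hg₁m.comp (measurable_subtype_coe.comp (AddCircle.measurableEquivIoc τ 0).measurable)
  have hGg : ∀ᵐ x : ℝ, G x = g x := by
    filter_upwards [hgg₁, ae_all_iff.2 (shift_zsmul hg₁τ)] with x h1 h2
    rw [← h1, ← h2 (-toIocDiv hτ 0 x)]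
    change g₁ (toIocMod hτ 0 x) = _
    rw [toIocMod, zsmul_eq_mul]
    congr 1
    push_cast
    ring
  rw [← integral_comp_mul_eq_zero_of_continuous AddCircle.measurable_mk' hw
    (fun c hc => integral_continuous_circle_mul_eq_zero hτ hw h0 hc) hGm (fun x => hC _)]
  refine integral_congr_ae ?_
  filter_upwards [hGg] with x hx
  rw [hx]

end Periodic

/-! ### The converse implication and the complex case -/

section Converse

variable {f g : ℝ → ℂ}

theorem commutator_realChar_eq_zero (hf : MemLp f ∞ volume) {b : ℝ}
    (hfb : (fun x => f (x + 2 * Real.pi * b)) =ᵐ[volume] f) :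
    ⁅funP f hf, funQ (realChar b) (memLp_top_realChar b)⁆ = 0 := by
  refine (commutator_eq_zero_iff hf _).2 fun p ψ => ?_
  obtain ⟨i1, i2⟩ := integrable_commSymbol_terms (memLp_top_realChar b) p ψ
  have hf' := memLp_top_comp_two_pi_mul hf
  simp only [commSymbol, mul_sub]
  rw [integral_sub (integrable_mul_of_memLp_top hf' i1) (integrable_mul_of_memLp_top hf' i2),
    sub_eq_zero]
  simp only [fourier_realChar_mul, fourierInv_realChar_mul]
  rw [← integral_add_right_eq_self _ b]
  refine integral_congr_ae ?_
  filter_upwards [(shift_two_pi_mul_iff b).2 hfb] with ξ hξ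
  rw [hξ, add_sub_cancel_right]

/-- The density w does not depend on g, so vanishing for characters can be extended to all periodic
g by tests against one L¹ function. -/
theorem inner_commutator_eq_integral (A : L2R →L[ℂ] L2R) (u v : L2R) :
    ∃ w : ℝ → ℂ, Integrable w ∧ ∀ (g : ℝ → ℂ) (hg : MemLp g ∞ volume),
      inner ℂ u (⁅A, funQ g hg⁆ v) = ∫ x, g x * w x := by
  have hi : ∀ a b : L2R, Integrable (fun x => (starRingEnd ℂ) (a x) * b x) := fun a b =>
    (Lp.memLp a).star.integrable_mul (Lp.memLp b)
  refine ⟨fun x => (starRingEnd ℂ) (A.adjoint u x) * v x - (starRingEnd ℂ) (u x) * A v x,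
    (hi _ _).sub (hi _ _), fun g hg => ?_⟩
  change inner ℂ u (A (funQ g hg v) - funQ g hg (A v)) = _
  simp only [mul_sub]
  rw [inner_sub_right, ← ContinuousLinearMap.adjoint_inner_left, inner_funQ, inner_funQ,
    integral_sub (integrable_mul_of_memLp_top hg (hi _ _))
      (integrable_mul_of_memLp_top hg (hi _ _))]

theorem commute_of_periodic (hf : MemLp f ∞ volume) (hg : MemLp g ∞ volume) {τf τg : ℝ}
    (hτf : 0 < τf) (hτg : 0 < τg) (hτ : τf * τg = 2 * Real.pi) (hfp : HasPeriodicVersion f τf)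
    (hgp : HasPeriodicVersion g τg) : ⁅funP f hf, funQ g hg⁆ = 0 := by
  rw [hasPeriodicVersion_iff hτf] at hfp
  rw [hasPeriodicVersion_iff hτg] at hgp
  refine ContinuousLinearMap.ext fun v => ext_inner_left ℂ fun u => ?_
  obtain ⟨w, hw, hwg⟩ := inner_commutator_eq_integral (funP f hf) u v
  rw [hwg g hg, integral_periodic_mul_eq_zero hτg hg hgp hw fun n => ?_]
  · simp
  · rw [← hwg _ (memLp_top_realChar _), commutator_realChar_eq_zero hf]
    · simp
    · have : 2 * Real.pi * (n / τg) = n * τf := by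
        rw [← hτ]; field_simp
      rw [this]
      exact shift_zsmul hfp n

theorem funQ_eq_smul_id (hg : MemLp g ∞ volume) {c : ℂ} (h : g =ᵐ[volume] fun _ => c) :
    funQ g hg = c • ContinuousLinearMap.id ℂ L2R := by
  refine ContinuousLinearMap.ext fun v => Lp.ext ?_
  filter_upwards [funQ_coeFn g hg v, h, Lp.coeFn_smul c v] with x h1 h2 h3
  rw [h1, h2]
  exact h3.symm

theorem funP_eq_smul_id (hf : MemLp f ∞ volume) {c : ℂ} (h : f =ᵐ[volume] fun _ => c) :
    funP f hf = c • ContinuousLinearMap.id ℂ L2R := by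
  have h' : (fun ξ => f (2 * Real.pi * ξ)) =ᵐ[volume] fun _ => c :=
    (quasiMeasurePreserving_const_mul Real.two_pi_pos.ne').ae h
  rw [funP, funQ_eq_smul_id _ h']
  ext1 v
  simp

theorem commutator_eq_zero_iff_const_or_periodic (hf : MemLp f ∞ volume) (hg : MemLp g ∞ volume) :
    ⁅funP f hf, funQ g hg⁆ = 0 ↔
      (IsAEConst f ∨ IsAEConst g) ∨
        ∃ τf τg : ℝ, 0 < τf ∧ 0 < τg ∧ τf * τg = 2 * Real.pi ∧
          HasPeriodicVersion f τf ∧ HasPeriodicVersion g τg := by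
  refine ⟨const_or_periodic_of_commute hf hg, ?_⟩
  rintro ((⟨c, hc⟩ | ⟨c, hc⟩) | ⟨τf, τg, h1, h2, h3, h4, h5⟩)
  · rw [funP_eq_smul_id hf hc]
    ext1 v
    simp [Bracket.bracket]
  · rw [funQ_eq_smul_id hg hc]
    ext1 v
    simp [Bracket.bracket]
  · exact commute_of_periodic hf hg h1 h2 h3 h4 h5

end Converse

/-! ### Reduction of the real case to the complex one -/

theorem ae_ofReal_eq_iff {a b : ℝ → ℝ} :
    (fun x => (a x : ℂ)) =ᵐ[volume] (fun x => (b x : ℂ)) ↔ a =ᵐ[volume] b :=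
  Filter.eventually_congr (Filter.Eventually.of_forall fun _ => Complex.ofReal_inj)

theorem isAEConst_ofReal_iff {f : ℝ → ℝ} : IsAEConst (fun x => (f x : ℂ)) ↔ IsAEConst f := by
  constructor
  · rintro ⟨c, hc⟩
    refine ⟨c.re, ?_⟩
    filter_upwards [hc] with x hx
    rw [← hx, Complex.ofReal_re]
  · rintro ⟨c, hc⟩
    exact ⟨c, ae_ofReal_eq_iff.2 hc⟩

theorem hasPeriodicVersion_ofReal_iff {f : ℝ → ℝ} {τ : ℝ} (hτ : 0 < τ) :
    HasPeriodicVersion (fun x => (f x : ℂ)) τ ↔ HasPeriodicVersion f τ := by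
  rw [hasPeriodicVersion_iff hτ, hasPeriodicVersion_iff hτ]
  exact ae_ofReal_eq_iff

theorem theorem1p2 :
    (∀ (f g : ℝ → ℝ) (hf : MemLp f ∞ volume) (hg : MemLp g ∞ volume),
      ⁅funP (fun x => (f x : ℂ)) hf.ofReal, funQ (fun x => (g x : ℂ)) hg.ofReal⁆ = 0 ↔
        (IsAEConst f ∨ IsAEConst g) ∨
          ∃ τf τg : ℝ, 0 < τf ∧ 0 < τg ∧ τf * τg = 2 * Real.pi ∧
            HasPeriodicVersion f τf ∧ HasPeriodicVersion g τg) ∧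
    (∀ (f g : ℝ → ℂ) (hf : MemLp f ∞ volume) (hg : MemLp g ∞ volume),
      ⁅funP f hf, funQ g hg⁆ = 0 ↔
        (IsAEConst f ∨ IsAEConst g) ∨
          ∃ τf τg : ℝ, 0 < τf ∧ 0 < τg ∧ τf * τg = 2 * Real.pi ∧
            HasPeriodicVersion f τf ∧ HasPeriodicVersion g τg) := by
  refine ⟨fun f g hf hg => ?_, fun f g hf hg => commutator_eq_zero_iff_const_or_periodic hf hg⟩
  rw [commutator_eq_zero_iff_const_or_periodic, isAEConst_ofReal_iff, isAEConst_ofReal_iff]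
  refine or_congr_right (exists_congr fun τf => exists_congr fun τg =>
    and_congr_right fun h1 => and_congr_right fun h2 => and_congr_right fun _ => ?_)
  rw [hasPeriodicVersion_ofReal_iff h1, hasPeriodicVersion_ofReal_iff h2]
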